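/- Let $k\ge 0$ be an integer and let $\mathbf c_i=(x_i,y_i)$, $1\le i\le n_c$, be planar rational Bézier curves of degrees $m_i$ with control points $(x_{i,j},y_{i,j})$ and positive control weights $w_{i,j}$: $$x_i(s)=\frac{\sum_{j=0}^{m_i} w_{i,j}x_{i,j}B^{m_i}_j(s)}{w_i(s)},\qquad y_i(s)=\frac{\sum_{j=0}^{m_i} w_{i,j}y_{i,j}B^{m_i}_j(s)}{w_i(s)},\qquad w_i(s)=\sum_{j=0}^{m_i} w_{i,j}B^{m_i}_j(s),$$ where $B^m_j(s)=\binom mj s^j(1-s)^{m-j}$. Let $\Omega\subset\mathbb R^2$ be a bounded region with $\partial\Omega=\bigcup_i \mathbf c_i([0,1])$, where the curves fit together, end point to starting point, to one or several closed loops, meet (themselves and each other) at most in end points, and are oriented such that, at every point $\mathbf c_i(s)$ with $0<s<1$ and $\mathbf c_i'(s)\ne 0$, the normal $(y_i'(s),-x_i'(s))$ points into $\Omega$ and its opposite points out of $\Omega$ (so an outer boundary loop is traversed clockwise). For a polynomial $f(x,y)$ and $C\in\mathbb R$ put $A_f(x,y)=\int_C^y f(x,t)\,dt$; with the above orientation Green's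 theorem reads $\iint_\Omega f\,dx\,dy=\sum_i\int_0^1 A_f(x_i(s),y_i(s))\,x_i'(s)\,ds$. Let $P=\lceil\frac{k+1}2\rceil$ and $Q_i=m_i(k+3)+1$. The Spectral PE rule is built from the following. * For each $i$, a rational quadrature rule on $[0,1]$ with $Q_i$ nodes $s_{i,q}\in[0,1]$ and weights $\gamma_{i,q}$ that is exact for the rational functions whose poles are the $m_i$ poles of $\mathbf c_i$ (the zeros of $w_i$, completed by poles at infinity if $\deg w_i<m_i$), each with multiplicity $k+3$; that is, for all $N(s)/w_i(s)^{k+3}$ with $N$ a real polynomial of degree at most $m_i(k+3)$. * The $P$-point Gauss–Legendre rule, with nodes $t_\zeta$ and weights $\lambda_\zeta$ on $[0,1]$, carried over to the interval from $C$ to $y_i(s_{i,q})$: nodes $y_{i,q,\zeta}=C+(y_i(s_{i,q})-C)t_\zeta$, weights $\gamma_{i,q,\zeta}=(y_i(s_{i,q})-C)\lambda_\zeta$. Its points are $(x_i(s_{i,q}),y_{i,q,\zeta})$ and its weights are $w_{i,q,\zeta}=\gamma_{i,q}\,\gamma_{i,q,\zeta}\,x_i'(s_{i,q})$, for $1\le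 i\le n_c$, $1\le q\le Q_i$, $1\le\zeta\le P$. Then: 1. For every polynomial $f$ of total degree at most $k$, every $C\in\mathbb R$ and every $i$, there is a polynomial $N$ of degree at most $m_i(k+3)$ such that $A_f(x_i(s),y_i(s))\,x_i'(s)=N(s)/w_i(s)^{k+3}$ for all real $s$ with $w_i(s)\neq0$. 2. The component rules exist: the $P$-point Gauss–Legendre rule, and, for each $i$, a rational rule as above with $Q_i$ distinct nodes in $(0,1)$. 3. The Spectral PE rule has $$n_q=\Bigl\lceil\frac{k+1}{2}\Bigr\rceil\sum_{i=1}^{n_c}\bigl(m_i(k+3)+1\bigr)$$ points (counted by the indices $(i,q,\zeta)$), and for every choice of component rules as above and every $C\in\mathbb R$ it integrates every polynomial $f$ of total degree at most $k$ exactly: $$\iint_\Omega f(x,y)\,dx\,dy=\sum_{i=1}^{n_c}\sum_{q=1}^{Q_i}\sum_{\zeta=1}^{P} w_{i,q,\zeta}\,f\bigl(x_i(s_{i,q}),y_{i,q,\zeta}\bigr).$$ -/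

import Mathlib

noncomputable section

namespace SpectralPE

/-- A planar rational Bernstein-Bézier curve of degree `m`: control weights, which are positive,
and control points. -/
structure RationalBezier (m : ℕ) where
  weight : Fin (m + 1) → ℝ
  weight_pos : ∀ j, 0 < weight j
  ctrlX : Fin (m + 1) → ℝ
  ctrlY : Fin (m + 1) → ℝ

namespace RationalBezier

variable {m : ℕ}

/-- The polynomial `∑ j, a j * B_j^m` with Bernstein coefficients `a`. -/
def bernsteinSum (a : Fin (m + 1) → ℝ) : Polynomial ℝ :=
  ∑ j : Fin (m + 1), Polynomial.C (a j) * bernsteinPolynomial ℝ m (j : ℕ)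

/-- The weight function (common denominator) `w(s)`; its zeros are the poles of the curve. -/
def w (c : RationalBezier m) : Polynomial ℝ :=
  bernsteinSum c.weight

/-- The first coordinate `x(s)` of the curve. -/
def x (c : RationalBezier m) (s : ℝ) : ℝ :=
  (bernsteinSum fun j => c.weight j * c.ctrlX j).eval s / c.w.eval s

/-- The second coordinate `y(s)` of the curve. -/
def y (c : RationalBezier m) (s : ℝ) : ℝ :=
  (bernsteinSum fun j => c.weight j * c.ctrlY j).eval s / c.w.eval s

/-- The point `(x(s), y(s))`. -/
def point (c : RationalBezier m) (s : ℝ) : ℝ × ℝ :=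
  (c.x s, c.y s)

end RationalBezier

/-- `Ω` is a bounded planar region whose oriented boundary consists of the curves `c i`,
`0 ≤ s ≤ 1`. The curves fit together to one or several closed loops, do not cross or overlap
(they meet at most in their end points), and at every regular point of a curve the normal
`(y', -x')` points into `Ω` and its opposite points out of `Ω`. -/
structure IsBoundedBy {n : ℕ} {m : Fin n → ℕ} (Ω : Set (ℝ × ℝ))
    (c : ∀ i, RationalBezier (m i)) : Prop where
  bounded : Bornology.IsBounded Ω
  frontier_eq : frontier Ω = ⋃ i, (c i).point '' Set.Icc 0 1
  closed_loops : ∃ next : Equiv.Perm (Fin n), ∀ i, (c i).point 1 = (c (next i)).point 0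
  simple : ∀ i j, ∀ s ∈ Set.Ioo (0 : ℝ) 1, ∀ t ∈ Set.Icc (0 : ℝ) 1,
    (c i).point s = (c j).point t → i = j ∧ s = t
  inward_normal : ∀ i, ∀ s ∈ Set.Ioo (0 : ℝ) 1,
    ¬ (deriv (c i).x s = 0 ∧ deriv (c i).y s = 0) →
    ∀ᶠ ε in nhdsWithin (0 : ℝ) (Set.Ioi 0),
      ((c i).x s + ε * deriv (c i).y s, (c i).y s - ε * deriv (c i).x s) ∈ Ω ∧
      ((c i).x s - ε * deriv (c i).y s, (c i).y s + ε * deriv (c i).x s) ∉ Ω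

/-- The value at `(a, b)` of a real polynomial in two variables. -/
def evalAt (f : MvPolynomial (Fin 2) ℝ) (a b : ℝ) : ℝ :=
  MvPolynomial.eval ![a, b] f

/-- The antiderivative in the second variable, `A_f(a, b) = ∫_C^b f(a, t) dt`. -/
def antideriv (f : MvPolynomial (Fin 2) ℝ) (C a b : ℝ) : ℝ :=
  ∫ t in C..b, evalAt f a t

/-- The `P`-point Gauss-Legendre rule for the interval `[0, 1]`: the nodes, in increasing order,
are zeros of the Legendre polynomial of degree `P`, shifted to `[0, 1]`, and the weights are the
integrals of the Lagrange basis polynomials. -/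
structure GaussRule (P : ℕ) where
  node : Fin P → ℝ
  weight : Fin P → ℝ
  node_strictMono : StrictMono node
  node_root : ∀ j, Polynomial.aeval (node j) (Polynomial.shiftedLegendre P) = 0
  weight_eq : ∀ j, weight j = ∫ u in (0 : ℝ)..1, (Lagrange.basis Finset.univ node j).eval u

/-- A rational quadrature rule on `[0, 1]` with `m (k + 3) + 1` points that is exact for the
rational functions whose poles are the `m` poles of the curve, each with multiplicity `k + 3`,
that is, for the functions `N / w ^ (k + 3)` with `deg N ≤ m (k + 3)`. If `deg w < m`, the missing
poles are poles at infinity. -/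
structure RationalRule {m : ℕ} (c : RationalBezier m) (k : ℕ) where
  node : Fin (m * (k + 3) + 1) → ℝ
  weight : Fin (m * (k + 3) + 1) → ℝ
  node_mem : ∀ q, node q ∈ Set.Icc (0 : ℝ) 1
  integrates : ∀ N : Polynomial ℝ, N.natDegree ≤ m * (k + 3) →
    ∑ q, weight q * (N.eval (node q) / c.w.eval (node q) ^ (k + 3)) =
      ∫ s in (0 : ℝ)..1, N.eval s / c.w.eval s ^ (k + 3)

/-- The index set `(i, q, ζ)` of the points of the Spectral PE rule with a `P`-point
antiderivative rule. -/
abbrev Index {n : ℕ} (m : Fin n → ℕ) (k P : ℕ) : Type :=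
  (Σ i : Fin n, Fin (m i * (k + 3) + 1)) × Fin P

/-- The points `(x_{i,q}, y_{i,q,ζ})` of the Spectral PE rule: `x_{i,q} = x_i(s_{i,q})`, and
`y_{i,q,ζ}` are the Gauss points of the interval from `C` to `y_i(s_{i,q})`. -/
def qPoint {n : ℕ} {m : Fin n → ℕ} {k P : ℕ} (c : ∀ i, RationalBezier (m i))
    (R : ∀ i, RationalRule (c i) k) (G : GaussRule P) (C : ℝ) (l : Index m k P) : ℝ × ℝ :=
  ((c l.1.1).x ((R l.1.1).node l.1.2),
    C + ((c l.1.1).y ((R l.1.1).node l.1.2) - C) * G.node l.2)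

/-- The weights `γ_{i,q} γ_{i,q,ζ} x_i'(s_{i,q})` of the Spectral PE rule, where the `γ_{i,q,ζ}` are
the Gauss weights of the interval from `C` to `y_i(s_{i,q})`. -/
def qWeight {n : ℕ} {m : Fin n → ℕ} {k P : ℕ} (c : ∀ i, RationalBezier (m i))
    (R : ∀ i, RationalRule (c i) k) (G : GaussRule P) (C : ℝ) (l : Index m k P) : ℝ :=
  (R l.1.1).weight l.1.2 *
    (((c l.1.1).y ((R l.1.1).node l.1.2) - C) * G.weight l.2) *
    deriv (c l.1.1).x ((R l.1.1).node l.1.2)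

end SpectralPE

end

noncomputable section

namespace SpectralPE

/-! The theorem has an algebraic and a geometric half, which meet in the line integrals of A_f(x, y)
x'.

Algebra: A_f has degree at most k + 1 in (x, y), so over the denominator w^(k+1) its numerator has
degree at most m(k+1); the factor x' contributes w^2 and 2m. Hence the line integrand lies in the
space on which the rational rule is exact (`exists_antideriv_mul_deriv_eq`). At each of its nodes
f(a, ·) has degree at most k < 2P, so the Gauss rule gives A_f exactly, by orthogonality of the
Legendre polynomial (`GaussRule.exact`). The rules exist because Rolle's theorem yields P distinct
Legendre zeros, and because interpolation at any distinct nodes of (0, 1) yields a rational rule.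

Geometry: Green's theorem (`IsBoundedBy.setIntegral_evalAt_eq`) follows from Fubini over vertical
lines. On each curve x is constant or has finitely many critical parameters, so all but finitely
many vertical lines meet the boundary in finitely many points, all with x' ≠ 0. There the boundary
is locally one arc close to its tangent, so the normal can be tilted to the vertical without
touching the boundary (`IsBoundedBy.eventually_vertical`): the region lies below if x' > 0, above if
x' < 0. A slice integral of f is thus the sum of sign(x') A_f over the crossings, and substituting a
= x(s) on each arc gives the line integrals. Cusps and vertical pieces lie over finitely many
abscissas and drop out. -/

/-! ### Legendre polynomials and Gauss quadrature -/

open Polynomial in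
/-- Repeated integration by parts for polynomials, with vanishing boundary terms. -/
theorem integral_iterate_derivative_mul (n : ℕ) (g t : ℝ[X])
    (h0 : ∀ i < n, (derivative^[i] g).eval 0 = 0) (h1 : ∀ i < n, (derivative^[i] g).eval 1 = 0) :
    ∫ u in (0 : ℝ)..1, (derivative^[n] g).eval u * t.eval u =
      (-1) ^ n * ∫ u in (0 : ℝ)..1, g.eval u * (derivative^[n] t).eval u := by
  induction n generalizing t with
  | zero => simp
  | succ n ih =>
    have hp := intervalIntegral.integral_mul_deriv_eq_deriv_mul (a := 0) (b := 1)
      (u := fun s => t.eval s) (v := fun s => (derivative^[n] g).eval s)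
      (u' := fun s => (derivative t).eval s) (v' := fun s => (derivative^[n + 1] g).eval s)
      (fun s _ => t.hasDerivAt s)
      (fun s _ => by
        rw [Function.iterate_succ_apply']
        exact (derivative^[n] g).hasDerivAt s)
      ((derivative t).continuous.intervalIntegrable _ _)
      ((derivative^[n + 1] g).continuous.intervalIntegrable _ _)
    rw [h0 n n.lt_succ_self, h1 n n.lt_succ_self] at hp
    have ih' := ih (derivative t) (fun i hi => h0 i (hi.trans n.lt_succ_self))
      (fun i hi => h1 i (hi.trans n.lt_succ_self))
    simp only [mul_zero, sub_zero, zero_sub] at hp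
    calc ∫ u in (0 : ℝ)..1, (derivative^[n + 1] g).eval u * t.eval u
        = ∫ u in (0 : ℝ)..1, t.eval u * (derivative^[n + 1] g).eval u := by simp only [mul_comm]
      _ = -∫ u in (0 : ℝ)..1, (derivative^[n] g).eval u * (derivative t).eval u := by
          rw [hp]; simp only [mul_comm]
      _ = _ := by
          rw [ih', Function.iterate_succ_apply]; ring

-- Each differentiation lowers the order of vanishing at 0 and at 1 by at most one, so fewer than n
-- of them leave a zero at both ends.
open Polynomial in
theorem eval_iterate_derivative_X_pow_mul_one_sub_X_pow {n i : ℕ} (hi : i < n) :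
    (derivative^[i] (X ^ n * (1 - X) ^ n : ℝ[X])).eval 0 = 0 ∧
      (derivative^[i] (X ^ n * (1 - X) ^ n : ℝ[X])).eval 1 = 0 := by
  constructor
  · obtain ⟨r, hr⟩ := pow_sub_dvd_iterate_derivative_of_pow_dvd i
      (Dvd.intro ((1 - X) ^ n) rfl : (X : ℝ[X]) ^ n ∣ X ^ n * (1 - X) ^ n)
    rw [hr]
    simp [Nat.sub_ne_zero_of_lt hi]
  · obtain ⟨r, hr⟩ := pow_sub_dvd_iterate_derivative_of_pow_dvd i
      (Dvd.intro_left (X ^ n) rfl : (1 - X : ℝ[X]) ^ n ∣ X ^ n * (1 - X) ^ n)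
    rw [hr]
    simp [Nat.sub_ne_zero_of_lt hi]

/-- The shifted Legendre polynomial with real coefficients. -/
def legendre (n : ℕ) : Polynomial ℝ :=
  (Polynomial.shiftedLegendre n).map (Int.castRingHom ℝ)

open Polynomial in
theorem degree_legendre (n : ℕ) : (legendre n).degree = n := by
  rw [legendre, degree_map_eq_of_injective (RingHom.injective_int _), degree_shiftedLegendre]

open Polynomial in
theorem legendre_ne_zero (n : ℕ) : legendre n ≠ 0 := by
  intro h
  have := degree_legendre n
  rw [h, degree_zero] at this
  exact WithBot.bot_ne_coe this

open Polynomial in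
theorem eval_legendre (n : ℕ) (x : ℝ) :
    (legendre n).eval x = aeval x (shiftedLegendre n) := by
  rw [legendre, eval_map, aeval_def]; rfl

-- Rodrigues' formula: both the orthogonality and the count of zeros are read off from it.
open Polynomial in
theorem factorial_mul_legendre (n : ℕ) :
    C (n.factorial : ℝ) * legendre n = derivative^[n] (X ^ n * (1 - X) ^ n : ℝ[X]) := by
  have h := congrArg (Polynomial.map (Int.castRingHom ℝ)) (factorial_mul_shiftedLegendre_eq n)
  rw [← iterate_derivative_map] at h
  simpa [legendre] using h

open Polynomial in
/-- The shifted Legendre polynomial is orthogonal to all polynomials of smaller degree. -/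
theorem integral_legendre_mul_eq_zero {n : ℕ} {t : ℝ[X]} (ht : t.degree < n) :
    ∫ u in (0 : ℝ)..1, (legendre n).eval u * t.eval u = 0 := by
  have h := integral_iterate_derivative_mul n (X ^ n * (1 - X) ^ n) t
    (fun i hi => (eval_iterate_derivative_X_pow_mul_one_sub_X_pow hi).1)
    (fun i hi => (eval_iterate_derivative_X_pow_mul_one_sub_X_pow hi).2)
  rw [iterate_derivative_eq_zero_of_degree_lt ht, ← factorial_mul_legendre] at h
  simp only [eval_mul, eval_C, eval_zero, mul_zero, intervalIntegral.integral_zero, mul_assoc,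
    intervalIntegral.integral_const_mul] at h
  exact (mul_eq_zero.1 h).resolve_left (by exact_mod_cast n.factorial_ne_zero)

-- Induction by Rolle: j + 2 distinct zeros produce j + 1 zeros of the next derivative that are not
-- among them, and 0 and 1 stay zeros as long as j < n.
open Polynomial in
theorem le_card_roots_iterate_derivative {n j : ℕ} (hj : j < n) :
    j + 2 ≤ (derivative^[j] (X ^ n * (1 - X) ^ n : ℝ[X])).roots.toFinset.card := by
  -- The zero polynomial has empty `roots`, so it must be excluded; if some derivative vanished, so
  -- would the n-th, a nonzero multiple of `legendre n`.
  have hne : ∀ j ≤ n, (derivative^[j] (X ^ n * (1 - X) ^ n : ℝ[X])) ≠ 0 := by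
    intro j hj h
    obtain ⟨d, rfl⟩ := Nat.exists_eq_add_of_le hj
    have h2 : derivative^[d] (derivative^[j] (X ^ (j + d) * (1 - X) ^ (j + d) : ℝ[X])) = 0 := by
      rw [h, iterate_derivative_zero]
    rw [← Function.iterate_add_apply, add_comm d j, ← factorial_mul_legendre] at h2
    rcases mul_eq_zero.1 h2 with h3 | h3
    · rw [C_eq_zero] at h3
      exact Nat.factorial_ne_zero _ (by exact_mod_cast h3)
    · exact legendre_ne_zero _ h3
  have hmem : ∀ j < n, ({0, 1} : Finset ℝ) ⊆
      (derivative^[j] (X ^ n * (1 - X) ^ n : ℝ[X])).roots.toFinset := by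
    intro j hj x hx
    rw [Multiset.mem_toFinset, mem_roots (hne j hj.le), IsRoot.def]
    rcases Finset.mem_insert.1 hx with rfl | hx
    · exact (eval_iterate_derivative_X_pow_mul_one_sub_X_pow hj).1
    · rw [Finset.mem_singleton.1 hx]
      exact (eval_iterate_derivative_X_pow_mul_one_sub_X_pow hj).2
  induction j with
  | zero => simpa using Finset.card_le_card (hmem 0 hj)
  | succ j ih =>
    have hj' : j < n := j.lt_succ_self.trans hj
    have h1 := card_roots_toFinset_le_card_roots_derivative_sdiff_roots_succ
      (derivative^[j] (X ^ n * (1 - X) ^ n : ℝ[X]))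
    rw [← Function.iterate_succ_apply' derivative, Nat.succ_eq_add_one] at h1
    have h2 := Finset.card_le_card (Finset.union_subset (hmem (j + 1) hj)
      (Finset.sdiff_subset (s := (derivative^[j + 1] (X ^ n * (1 - X) ^ n : ℝ[X])).roots.toFinset)
        (t := (derivative^[j] (X ^ n * (1 - X) ^ n : ℝ[X])).roots.toFinset)))
    rw [Finset.card_union_of_disjoint
      (Finset.disjoint_of_subset_left (hmem j hj') Finset.disjoint_sdiff),
      Finset.card_pair zero_ne_one] at h2
    have := ih hj'
    omega

open Polynomial in
theorem card_roots_legendre (n : ℕ) : (legendre n).roots.toFinset.card = n := by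
  apply le_antisymm
  · refine (Multiset.toFinset_card_le _).trans ((card_roots' _).trans ?_)
    rw [natDegree_eq_of_degree_eq_some (degree_legendre n)]
  · rcases n with _ | n
    · exact Nat.zero_le _
    · have h1 := le_card_roots_iterate_derivative n.lt_add_one
      have h2 := card_roots_toFinset_le_derivative
        (derivative^[n] (X ^ (n + 1) * (1 - X) ^ (n + 1) : ℝ[X]))
      rw [← Function.iterate_succ_apply' derivative, Nat.succ_eq_add_one, ← factorial_mul_legendre,
        roots_C_mul _ (by exact_mod_cast Nat.factorial_ne_zero _)] at h2
      omega

/-- The `P`-point Gauss-Legendre rule exists. -/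
theorem nonempty_gaussRule (P : ℕ) : Nonempty (GaussRule P) := by
  let e := (legendre P).roots.toFinset.orderEmbOfFin (card_roots_legendre P)
  refine ⟨⟨e, _, e.strictMono, fun j => ?_, fun j => rfl⟩⟩
  have h := (legendre P).roots.toFinset.orderEmbOfFin_mem (card_roots_legendre P) j
  rw [Multiset.mem_toFinset, Polynomial.mem_roots (legendre_ne_zero P)] at h
  rw [← eval_legendre]
  exact h

open Polynomial in
/-- Lagrange interpolation at distinct nodes, evaluated at a point. -/
theorem eval_eq_sum_lagrange {ι : Type*} [Fintype ι] [DecidableEq ι] {v : ι → ℝ}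
    (hv : Function.Injective v) {p : ℝ[X]} (hp : p.degree < Fintype.card ι) (u : ℝ) :
    p.eval u = ∑ j, p.eval (v j) * (Lagrange.basis Finset.univ v j).eval u := by
  conv_lhs => rw [Lagrange.eq_interpolate (f := p) (s := Finset.univ) hv.injOn (by simpa using hp),
    Lagrange.interpolate_apply]
  simp [eval_finsetSum]

open Polynomial in
/-- The `P`-point Gauss-Legendre rule is exact for polynomials of degree less than `2 P`. -/
theorem GaussRule.exact {P : ℕ} (G : GaussRule P) {q : ℝ[X]} (hq : q.degree < (2 * P : ℕ)) :
    ∑ j, G.weight j * q.eval (G.node j) = ∫ u in (0 : ℝ)..1, q.eval u := by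
  set L := legendre P with hL
  have hL0 : L ≠ 0 := legendre_ne_zero P
  have hdeg : L.degree = P := degree_legendre P
  have hint : ∀ p : ℝ[X], IntervalIntegrable (fun u => p.eval u) MeasureTheory.volume 0 1 :=
    fun p => p.continuous.intervalIntegrable _ _
  -- In q = L (q / L) + q % L the first term vanishes at the nodes and has integral 0, since deg (q
  -- / L) < P; the remainder is integrated exactly by interpolation.
  have hr : (q % L).degree < Fintype.card (Fin P) := by
    rw [Fintype.card_fin, ← hdeg]
    exact EuclideanDomain.mod_lt q hL0
  have ht : (q / L).degree < P := by
    by_cases h : L.degree ≤ q.degree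
    · have h1 := degree_add_div hL0 h
      rw [hdeg] at h1
      rw [← h1, two_mul, Nat.cast_add] at hq
      exact lt_of_add_lt_add_left hq
    · rw [(Polynomial.div_eq_zero_iff hL0).2 (not_le.1 h), degree_zero]
      exact WithBot.bot_lt_coe _
  have hnode : ∀ j, L.eval (G.node j) = 0 := fun j => by
    rw [hL, eval_legendre]; exact G.node_root j
  have hqr : ∀ u, q.eval u = L.eval u * (q / L).eval u + (q % L).eval u := fun u => by
    conv_lhs => rw [← EuclideanDomain.div_add_mod q L]
    rw [eval_add, eval_mul]
  calc ∑ j, G.weight j * q.eval (G.node j)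
      = ∑ j, ∫ u in (0 : ℝ)..1,
          (q % L).eval (G.node j) * (Lagrange.basis Finset.univ G.node j).eval u := by
        refine Finset.sum_congr rfl fun j _ => ?_
        rw [hqr, hnode, zero_mul, zero_add, G.weight_eq, intervalIntegral.integral_const_mul,
          mul_comm]
    _ = ∫ u in (0 : ℝ)..1, (q % L).eval u := by
        rw [← intervalIntegral.integral_finsetSum fun j _ => (hint _).const_mul _]
        exact intervalIntegral.integral_congr fun u _ =>
          (eval_eq_sum_lagrange G.node_strictMono.injective hr u).symm
    _ = ∫ u in (0 : ℝ)..1, (L.eval u * (q / L).eval u + (q % L).eval u) := by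
        rw [intervalIntegral.integral_add, integral_legendre_mul_eq_zero ht, zero_add]
        · simpa using hint (L * (q / L))
        · exact hint _
    _ = _ := by simp only [hqr]

/-! ### Numerators, denominators and derivatives of the curves -/

namespace RationalBezier

open Polynomial

variable {m : ℕ}

theorem natDegree_bernsteinSum_le (a : Fin (m + 1) → ℝ) : (bernsteinSum a).natDegree ≤ m := by
  refine natDegree_sum_le_of_forall_le _ _ fun j _ => ?_
  refine (natDegree_C_mul_le _ _).trans ?_
  have hj : (j : ℕ) ≤ m := Nat.lt_succ_iff.1 j.2
  rw [bernsteinPolynomial]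
  compute_degree
  omega

/-- The numerator of the first coordinate. -/
def numX (c : RationalBezier m) : ℝ[X] := bernsteinSum fun j => c.weight j * c.ctrlX j

/-- The numerator of the second coordinate. -/
def numY (c : RationalBezier m) : ℝ[X] := bernsteinSum fun j => c.weight j * c.ctrlY j

/-- The numerator of the derivative of the first coordinate, over the denominator `w ^ 2`. -/
def numDerivX (c : RationalBezier m) : ℝ[X] :=
  derivative c.numX * c.w - c.numX * derivative c.w

/-- The numerator of the derivative of the second coordinate, over the denominator `w ^ 2`. -/
def numDerivY (c : RationalBezier m) : ℝ[X] :=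
  derivative c.numY * c.w - c.numY * derivative c.w

theorem natDegree_w_le (c : RationalBezier m) : c.w.natDegree ≤ m := natDegree_bernsteinSum_le _

theorem natDegree_numX_le (c : RationalBezier m) : c.numX.natDegree ≤ m :=
  natDegree_bernsteinSum_le _

theorem natDegree_numY_le (c : RationalBezier m) : c.numY.natDegree ≤ m :=
  natDegree_bernsteinSum_le _

/-- Not sharp, since the leading terms cancel, but 2m is what the degree m(k+3) leaves room for. -/
theorem natDegree_numDerivX_le (c : RationalBezier m) : c.numDerivX.natDegree ≤ 2 * m := by
  have h1 := c.natDegree_w_le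
  have h2 := c.natDegree_numX_le
  have h3 := natDegree_derivative_le c.w
  have h4 := natDegree_derivative_le c.numX
  refine (natDegree_sub_le_of_le natDegree_mul_le natDegree_mul_le).trans ?_
  rw [max_le_iff]
  constructor <;> omega

/-- On [0, 1] the Bernstein polynomials are nonnegative with sum 1, so at least one is positive. -/
theorem w_pos (c : RationalBezier m) {s : ℝ} (hs : s ∈ Set.Icc (0 : ℝ) 1) : 0 < c.w.eval s := by
  have hb : ∀ j : Fin (m + 1), 0 ≤ (bernsteinPolynomial ℝ m (j : ℕ)).eval s := by
    intro j
    have h1 : 0 ≤ 1 - s := sub_nonneg.2 hs.2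
    have h0 := hs.1
    simp only [bernsteinPolynomial, eval_mul, eval_natCast, eval_pow, eval_X, eval_sub, eval_one]
    positivity
  have hsum : ∑ j : Fin (m + 1), (bernsteinPolynomial ℝ m (j : ℕ)).eval s = 1 := by
    rw [Fin.sum_univ_eq_sum_range fun j => (bernsteinPolynomial ℝ m j).eval s,
      ← eval_finsetSum, bernsteinPolynomial.sum, eval_one]
  obtain ⟨j, -, hj⟩ : ∃ j ∈ Finset.univ, (0 : ℝ) <
      (bernsteinPolynomial ℝ m ((j : Fin (m + 1)) : ℕ)).eval s := by
    apply Finset.exists_lt_of_sum_lt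
    rw [hsum]
    simp
  simp only [w, bernsteinSum, eval_finsetSum, eval_mul, eval_C]
  exact Finset.sum_pos' (fun j _ => mul_nonneg (c.weight_pos j).le (hb j))
    ⟨j, Finset.mem_univ _, mul_pos (c.weight_pos j) hj⟩

theorem w_ne_zero (c : RationalBezier m) {s : ℝ} (hs : s ∈ Set.Icc (0 : ℝ) 1) :
    c.w.eval s ≠ 0 :=
  (c.w_pos hs).ne'

theorem hasDerivAt_x (c : RationalBezier m) {s : ℝ} (hs : c.w.eval s ≠ 0) :
    HasDerivAt c.x (c.numDerivX.eval s / c.w.eval s ^ 2) s := by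
  have h := (c.numX.hasDerivAt s).div (c.w.hasDerivAt s) hs
  simp only [numDerivX, eval_sub, eval_mul]
  exact h

theorem hasDerivAt_y (c : RationalBezier m) {s : ℝ} (hs : c.w.eval s ≠ 0) :
    HasDerivAt c.y (c.numDerivY.eval s / c.w.eval s ^ 2) s := by
  have h := (c.numY.hasDerivAt s).div (c.w.hasDerivAt s) hs
  simp only [numDerivY, eval_sub, eval_mul]
  exact h

theorem deriv_x (c : RationalBezier m) {s : ℝ} (hs : c.w.eval s ≠ 0) :
    deriv c.x s = c.numDerivX.eval s / c.w.eval s ^ 2 :=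
  (c.hasDerivAt_x hs).deriv

theorem continuousOn_deriv_x (c : RationalBezier m) :
    ContinuousOn (deriv c.x) (Set.Icc 0 1) := by
  have h : ContinuousOn (fun s => c.numDerivX.eval s / c.w.eval s ^ 2) (Set.Icc 0 1) :=
    c.numDerivX.continuous.continuousOn.div (c.w.continuous.continuousOn.pow 2)
      fun s hs => pow_ne_zero 2 (c.w_ne_zero hs)
  exact h.congr fun s hs => c.deriv_x (c.w_ne_zero hs)

theorem continuousOn_x (c : RationalBezier m) : ContinuousOn c.x (Set.Icc 0 1) :=
  fun _ hs => (c.hasDerivAt_x (c.w_ne_zero hs)).continuousAt.continuousWithinAt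

theorem continuousOn_y (c : RationalBezier m) : ContinuousOn c.y (Set.Icc 0 1) :=
  fun _ hs => (c.hasDerivAt_y (c.w_ne_zero hs)).continuousAt.continuousWithinAt

theorem continuousOn_point (c : RationalBezier m) : ContinuousOn c.point (Set.Icc 0 1) :=
  c.continuousOn_x.prodMk c.continuousOn_y

end RationalBezier

/-! ### The antiderivative and the line integrand -/

theorem evalAt_eq_sum (f : MvPolynomial (Fin 2) ℝ) (a b : ℝ) :
    evalAt f a b = ∑ d ∈ f.support, f.coeff d * (a ^ d 0 * b ^ d 1) := by
  simp [evalAt, MvPolynomial.eval_eq', Fin.prod_univ_two]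

theorem continuous_evalAt (f : MvPolynomial (Fin 2) ℝ) :
    Continuous fun p : ℝ × ℝ => evalAt f p.1 p.2 := by
  simp only [evalAt_eq_sum]
  fun_prop

theorem continuous_evalAt_right (f : MvPolynomial (Fin 2) ℝ) (a : ℝ) :
    Continuous fun t => evalAt f a t := by
  simp only [evalAt_eq_sum]
  fun_prop

theorem antideriv_eq_sum (f : MvPolynomial (Fin 2) ℝ) (C a b : ℝ) :
    antideriv f C a b = ∑ d ∈ f.support,
      f.coeff d * (a ^ d 0 * ((b ^ (d 1 + 1) - C ^ (d 1 + 1)) / ((d 1 : ℕ) + 1 : ℝ))) := by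
  simp only [antideriv, evalAt_eq_sum]
  rw [intervalIntegral.integral_finsetSum]
  · simp only [intervalIntegral.integral_const_mul, integral_pow]
  · intro d _
    apply Continuous.intervalIntegrable
    fun_prop

theorem RationalBezier.continuousOn_antideriv {m : ℕ} (c : RationalBezier m)
    (f : MvPolynomial (Fin 2) ℝ) (C : ℝ) :
    ContinuousOn (fun s => antideriv f C (c.x s) (c.y s)) (Set.Icc 0 1) := by
  have hx := c.continuousOn_x
  have hy := c.continuousOn_y
  simp only [antideriv_eq_sum]
  fun_prop

theorem hasDerivAt_antideriv (f : MvPolynomial (Fin 2) ℝ) (C a b : ℝ) :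
    HasDerivAt (antideriv f C a) (evalAt f a b) b := by
  have hc := continuous_evalAt_right f a
  exact intervalIntegral.integral_hasDerivAt_right (hc.intervalIntegrable _ _)
    (hc.stronglyMeasurableAtFilter _ _) hc.continuousAt

theorem add_le_of_mem_support {f : MvPolynomial (Fin 2) ℝ} {k : ℕ} (hf : f.totalDegree ≤ k)
    {d : Fin 2 →₀ ℕ} (hd : d ∈ f.support) : d 0 + d 1 ≤ k := by
  have h := (MvPolynomial.le_totalDegree hd).trans hf
  rwa [Finsupp.sum_fintype _ _ (fun _ => rfl), Fin.sum_univ_two] at h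

open Polynomial in
/-- The line integrand `A_f(x, y) x'` is a rational function with denominator `w ^ (k + 3)`. -/
theorem exists_antideriv_mul_deriv_eq {m k : ℕ} (c : RationalBezier m)
    {f : MvPolynomial (Fin 2) ℝ} (hf : f.totalDegree ≤ k) (a : ℝ) :
    ∃ N : ℝ[X], N.natDegree ≤ m * (k + 3) ∧ ∀ s : ℝ, c.w.eval s ≠ 0 →
      antideriv f a (c.x s) (c.y s) * deriv c.x s = N.eval s / c.w.eval s ^ (k + 3) := by
  -- The powers of w raise every term to the common denominator: d 0 + (d 1 + 1) + (k - d 0 - d 1) +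
  -- 2 = k + 3, and without the power of y, d 0 + (k + 1 - d 0) + 2 = k + 3.
  refine ⟨∑ d ∈ f.support, C (f.coeff d / ((d 1 : ℕ) + 1 : ℝ)) * (c.numX ^ d 0 *
    (c.numY ^ (d 1 + 1) * c.w ^ (k - d 0 - d 1) -
      C (a ^ (d 1 + 1)) * c.w ^ (k + 1 - d 0)) * c.numDerivX), ?_, ?_⟩
  · refine natDegree_sum_le_of_forall_le _ _ fun d hd => ?_
    have hdk := add_le_of_mem_support hf hd
    have hX := c.natDegree_numX_le
    have hY := c.natDegree_numY_le
    have hw := c.natDegree_w_le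
    refine (natDegree_C_mul_le _ _).trans ((natDegree_mul_le_of_le (natDegree_mul_le_of_le
      (natDegree_pow_le_of_le (d 0) hX) (natDegree_sub_le_of_le
        (natDegree_mul_le_of_le (natDegree_pow_le_of_le (d 1 + 1) hY)
          (natDegree_pow_le_of_le (k - d 0 - d 1) hw))
        ((natDegree_C_mul_le _ _).trans (natDegree_pow_le_of_le (k + 1 - d 0) hw))))
      c.natDegree_numDerivX_le).trans ?_)
    obtain ⟨e, rfl⟩ := Nat.exists_eq_add_of_le hdk
    rw [show d 0 + d 1 + e - d 0 - d 1 = e by omega,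
      show d 0 + d 1 + e + 1 - d 0 = d 1 + 1 + e by omega, ← add_mul, max_self]
    apply le_of_eq
    ring
  · intro s hs
    rw [antideriv_eq_sum, c.deriv_x hs, Finset.sum_mul, eval_finsetSum, Finset.sum_div]
    refine Finset.sum_congr rfl fun d hd => ?_
    obtain ⟨e, rfl⟩ := Nat.exists_eq_add_of_le (add_le_of_mem_support hf hd)
    rw [show d 0 + d 1 + e - d 0 - d 1 = e by omega,
      show d 0 + d 1 + e + 1 - d 0 = d 1 + 1 + e by omega]
    have hx : c.x s = c.numX.eval s / c.w.eval s := rfl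
    have hy : c.y s = c.numY.eval s / c.w.eval s := rfl
    have hd1 : ((d 1 : ℕ) + 1 : ℝ) ≠ 0 := by positivity
    simp only [hx, hy, eval_mul, eval_sub, eval_pow, eval_C]
    rw [div_pow, div_pow]
    field_simp
    ring

/-! ### The rational rule and the combined rule -/

open Polynomial in
/-- The interpolatory rational rule with given distinct nodes in `(0, 1)`. -/
theorem exists_rationalRule {m : ℕ} (c : RationalBezier m) (k : ℕ) :
    ∃ R : RationalRule c k, Function.Injective R.node ∧ ∀ q, R.node q ∈ Set.Ioo (0 : ℝ) 1 := by
  set Q := m * (k + 3) + 1 with hQ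
  -- Any distinct nodes would do; the shifts by one keep these off the end points.
  let v : Fin Q → ℝ := fun q => ((q : ℕ) + 1) / (Q + 1)
  have hQ0 : (0 : ℝ) < Q + 1 := by positivity
  have hv : Function.Injective v := by
    intro p q h
    have h' := (div_left_inj' hQ0.ne').1 h
    exact Fin.ext (by exact_mod_cast add_right_cancel h')
  have hmem : ∀ q, v q ∈ Set.Ioo (0 : ℝ) 1 := by
    intro q
    refine ⟨by positivity, (div_lt_one hQ0).2 ?_⟩
    exact_mod_cast Nat.succ_lt_succ q.2
  have hint : ∀ p : ℝ[X], IntervalIntegrable (fun s => p.eval s / c.w.eval s ^ (k + 3))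
      MeasureTheory.volume 0 1 := by
    intro p
    apply ContinuousOn.intervalIntegrable
    rw [Set.uIcc_of_le zero_le_one]
    exact p.continuous.continuousOn.div (c.w.continuous.continuousOn.pow _)
      fun s hs => pow_ne_zero _ (c.w_ne_zero hs)
  -- The functions N / w^(k+3) have the cardinal basis ℓ_q(s) w(v_q)^(k+3) / w(s)^(k+3), whose
  -- integrals are the weights.
  refine ⟨⟨v, fun q => c.w.eval (v q) ^ (k + 3) * ∫ s in (0 : ℝ)..1,
    (Lagrange.basis Finset.univ v q).eval s / c.w.eval s ^ (k + 3),
    fun q => Set.Ioo_subset_Icc_self (hmem q), fun N hN => ?_⟩, hv, hmem⟩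
  have hdeg : N.degree < Fintype.card (Fin Q) := by
    rw [Fintype.card_fin]
    exact degree_le_natDegree.trans_lt (by exact_mod_cast Nat.lt_succ_of_le hN)
  calc _ = ∑ q, ∫ s in (0 : ℝ)..1, N.eval (v q) *
        ((Lagrange.basis Finset.univ v q).eval s / c.w.eval s ^ (k + 3)) := by
        refine Finset.sum_congr rfl fun q _ => ?_
        have := pow_ne_zero (k + 3) (c.w_ne_zero (Set.Ioo_subset_Icc_self (hmem q)))
        rw [intervalIntegral.integral_const_mul]
        field_simp
    _ = _ := by
        rw [← intervalIntegral.integral_finsetSum fun q _ => (hint _).const_mul _]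
        refine intervalIntegral.integral_congr fun s _ => ?_
        rw [eval_eq_sum_lagrange hv hdeg s, Finset.sum_div]
        exact Finset.sum_congr rfl fun q _ => (mul_div_assoc _ _ _).symm

open Polynomial in
/-- The Gauss-Legendre rule carried over to the interval from `C` to `b` integrates `f(a, ·)`. -/
theorem GaussRule.sum_eq_antideriv {k P : ℕ} (G : GaussRule P) (hP : k < 2 * P)
    {f : MvPolynomial (Fin 2) ℝ} (hf : f.totalDegree ≤ k) (a b z : ℝ) :
    ∑ j, (b - z) * G.weight j * evalAt f a (z + (b - z) * G.node j) = antideriv f z a b := by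
  let q : ℝ[X] := ∑ d ∈ f.support,
    C (f.coeff d) * (C (a ^ d 0) * (C z + C (b - z) * X) ^ d 1)
  have hq : ∀ u, q.eval u = evalAt f a (z + (b - z) * u) := by
    intro u
    simp [q, evalAt_eq_sum, eval_finsetSum]
  have hdeg : q.degree < (2 * P : ℕ) := by
    have h1 : q.natDegree ≤ k := by
      refine natDegree_sum_le_of_forall_le _ _ fun d hd => ?_
      have := add_le_of_mem_support hf hd
      refine (natDegree_C_mul_le _ _).trans ((natDegree_C_mul_le _ _).trans ?_)
      have h2 : (C z + C (b - z) * X).natDegree ≤ 1 := by compute_degree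
      refine (natDegree_pow_le_of_le (d 1) h2).trans ?_
      omega
    exact degree_le_natDegree.trans_lt (by exact_mod_cast h1.trans_lt hP)
  simp only [mul_assoc, ← hq]
  rw [← Finset.mul_sum, G.exact hdeg, antideriv]
  simp only [hq]
  simp

/-- The combined rule computes the sum of the line integrals of `A_f(x, y) x'`. -/
theorem sum_qWeight_mul_eq {n k P : ℕ} {m : Fin n → ℕ} (c : ∀ i, RationalBezier (m i))
    (R : ∀ i, RationalRule (c i) k) (G : GaussRule P) (hP : k < 2 * P) (C : ℝ)
    {f : MvPolynomial (Fin 2) ℝ} (hf : f.totalDegree ≤ k) :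
    ∑ l, qWeight c R G C l * evalAt f (qPoint c R G C l).1 (qPoint c R G C l).2 =
      ∑ i, ∫ s in (0 : ℝ)..1, antideriv f C ((c i).x s) ((c i).y s) * deriv (c i).x s := by
  rw [Fintype.sum_prod_type, Fintype.sum_sigma]
  refine Finset.sum_congr rfl fun i _ => ?_
  obtain ⟨N, hN, hNs⟩ := exists_antideriv_mul_deriv_eq (c i) hf C
  have hI : ∫ s in (0 : ℝ)..1, antideriv f C ((c i).x s) ((c i).y s) * deriv (c i).x s =
      ∫ s in (0 : ℝ)..1, N.eval s / (c i).w.eval s ^ (k + 3) := by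
    refine intervalIntegral.integral_congr fun s hs => ?_
    rw [Set.uIcc_of_le zero_le_one] at hs
    exact hNs s ((c i).w_ne_zero hs)
  rw [hI, ← (R i).integrates N hN]
  refine Finset.sum_congr rfl fun q _ => ?_
  rw [← hNs _ ((c i).w_ne_zero ((R i).node_mem q)), ← G.sum_eq_antideriv hP hf, Finset.sum_mul,
    Finset.mul_sum]
  refine Finset.sum_congr rfl fun j _ => ?_
  simp only [qWeight, qPoint]
  ring

/-! ### Integrals over slices as sums over crossings -/

open Set Filter Topology MeasureTheory

theorem eventually_mem_iff_of_notMem_frontier {α : Type*} [TopologicalSpace α] {U : Set α} {p : α}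
    (hp : p ∉ frontier U) : ∀ᶠ q in 𝓝 p, (q ∈ U ↔ p ∈ U) := by
  by_cases h : p ∈ interior U
  · filter_upwards [isOpen_interior.mem_nhds h] with q hq
    exact iff_of_true (interior_subset hq) (interior_subset h)
  · have h' : p ∉ closure U := fun hc => hp ⟨hc, h⟩
    filter_upwards [isClosed_closure.isOpen_compl.mem_nhds h'] with q hq
    exact iff_of_false (fun h => hq (subset_closure h)) fun h => h' (subset_closure h)

/-- A locally constant real function on an interval is constant. -/
theorem eq_left_of_eventually_eq {χ : ℝ → ℝ} {a b : ℝ}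
    (h : ∀ x ∈ Icc a b, ∀ᶠ y in 𝓝 x, χ y = χ x) : ∀ x ∈ Icc a b, χ x = χ a := by
  have hd : ∀ x ∈ Icc a b, HasDerivAt χ 0 x := fun x hx =>
    (hasDerivAt_const x (χ x)).congr_of_eventuallyEq (h x hx)
  exact constant_of_has_deriv_right_zero
    (fun x hx => (hd x hx).continuousAt.continuousWithinAt)
    (fun x hx => (hd x (Ico_subset_Icc_self hx)).hasDerivWithinAt)

/-- The integral of a step function times a derivative is the sum of the jumps times the values of
the antiderivative, plus boundary terms. -/
theorem integral_mul_eq_sum_jumps {g A σ : ℝ → ℝ} (hg : Continuous g)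
    (hA : ∀ t, HasDerivAt A (g t) t) (F : Finset ℝ) (χ : ℝ → ℝ) (a : ℝ) :
    ∀ b, a < b → (∀ t ∈ F, t ∈ Ioo a b) →
      (∀ x ∈ Icc a b, x ∉ F → ∀ᶠ y in 𝓝 x, χ y = χ x) →
      (∀ t ∈ F, ∃ l r, l - r = σ t ∧ (∀ᶠ y in 𝓝[<] t, χ y = l) ∧ ∀ᶠ y in 𝓝[>] t, χ y = r) →
      IntervalIntegrable (fun t => χ t * g t) volume a b ∧
        ∫ t in a..b, χ t * g t = ∑ t ∈ F, σ t * A t + χ b * A b - χ a * A a := by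
  have hconst : ∀ (u v r : ℝ), u ≤ v → (∀ y ∈ Ioo u v, χ y = r) →
      IntervalIntegrable (fun t => χ t * g t) volume u v ∧
        ∫ t in u..v, χ t * g t = r * (A v - A u) := by
    intro u v r huv h
    have heq : EqOn (fun t => r * g t) (fun t => χ t * g t) (uIoo u v) := by
      rw [uIoo_of_le huv]
      intro y hy
      simp only [h y hy]
    have hi : IntervalIntegrable (fun t => r * g t) volume u v :=
      (hg.const_mul r).intervalIntegrable _ _
    refine ⟨hi.congr_uIoo heq, ?_⟩
    rw [← intervalIntegral.integral_congr_uIoo heq, intervalIntegral.integral_const_mul,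
      intervalIntegral.integral_eq_sub_of_hasDerivAt (fun t _ => hA t) (hg.intervalIntegrable _ _)]
  induction F using Finset.induction_on_max with
  | empty =>
    intro b hab _ hloc _
    have hc := eq_left_of_eventually_eq fun x hx => hloc x hx (Finset.notMem_empty x)
    obtain ⟨h1, h2⟩ := hconst a b (χ a) hab.le fun y hy => hc y (Ioo_subset_Icc_self hy)
    refine ⟨h1, ?_⟩
    rw [h2, hc b (right_mem_Icc.2 hab.le), Finset.sum_empty]
    ring
  | insert t F hmax ih =>
    intro b hab hF hloc hjump
    have ht := hF t (Finset.mem_insert_self t F)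
    obtain ⟨l, r, hlr, hl, hr⟩ := hjump t (Finset.mem_insert_self t F)
    -- Choose d past all other jumps, where χ already has its left value l at t: the induction
    -- hypothesis covers [a, d], and χ is constant on (d, t) and on (t, b]. The terms l A(d) cancel.
    have hbefore : ∀ᶠ y in 𝓝[<] t, a < y ∧ (∀ x ∈ F, x < y) ∧ y < t ∧ χ y = l := by
      refine (eventually_nhdsWithin_of_eventually_nhds (lt_mem_nhds ht.1)).and (.and ?_
        (.and eventually_mem_nhdsWithin hl))
      refine (Finset.eventually_all F).2 fun x hx => ?_
      exact eventually_nhdsWithin_of_eventually_nhds (lt_mem_nhds (hmax x hx))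
    obtain ⟨d, had, hFd, hdt, hχd⟩ := hbefore.exists
    have hFs : ∀ x ∈ F, x ∈ insert t F := fun x hx => Finset.mem_insert_of_mem hx
    obtain ⟨h1, h2⟩ := ih d had (fun x hx => ⟨(hF x (hFs x hx)).1, hFd x hx⟩)
      (fun x hx hxF => hloc x ⟨hx.1, hx.2.trans (hdt.le.trans ht.2.le)⟩ (by
        rw [Finset.mem_insert, not_or]
        exact ⟨(hx.2.trans_lt hdt).ne, hxF⟩))
      (fun x hx => hjump x (hFs x hx))
    have hleft : ∀ y ∈ Ioo d t, χ y = l := by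
      intro y hy
      rw [← hχd]
      refine eq_left_of_eventually_eq (fun x hx => hloc x ⟨had.le.trans hx.1,
        hx.2.trans (hy.2.le.trans ht.2.le)⟩ ?_) y ⟨hy.1.le, le_rfl⟩
      rw [Finset.mem_insert, not_or]
      exact ⟨(hx.2.trans_lt hy.2).ne, fun hxF => (hFd x hxF).not_ge hx.1⟩
    have hright : ∀ y ∈ Ioc t b, χ y = r := by
      intro y hy
      have hev : ∀ᶠ z in 𝓝[>] t, t < z ∧ z < y ∧ χ z = r :=
        eventually_mem_nhdsWithin.and
          ((eventually_nhdsWithin_of_eventually_nhds (gt_mem_nhds hy.1)).and hr)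
      obtain ⟨z, htz, hzy, hχz⟩ := hev.exists
      rw [← hχz]
      refine eq_left_of_eventually_eq (fun x hx => hloc x ⟨(ht.1.trans (htz.trans_le hx.1)).le,
        hx.2.trans hy.2⟩ ?_) y ⟨hzy.le, le_rfl⟩
      rw [Finset.mem_insert, not_or]
      exact ⟨(htz.trans_le hx.1).ne', fun hxF => ((hmax x hxF).trans (htz.trans_le hx.1)).false⟩
    obtain ⟨h3, h4⟩ := hconst d t l hdt.le hleft
    obtain ⟨h5, h6⟩ := hconst t b r ht.2.le fun y hy => hright y ⟨hy.1, hy.2.le⟩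
    refine ⟨(h1.trans h3).trans h5, ?_⟩
    rw [← intervalIntegral.integral_add_adjacent_intervals (h1.trans h3) h5,
      ← intervalIntegral.integral_add_adjacent_intervals h1 h3, h2, h4, h6, hχd,
      hright b ⟨ht.2, le_rfl⟩, Finset.sum_insert fun h => (hmax t h).false, ← hlr]
    ring

/-- The integral of a function over a bounded set of reals with finitely many boundary points, all
of them crossings, as the sum of the signed values of the antiderivative. The points are given by an
injective family `τ`; `σ e = 1` if the set lies below `τ e` and `σ e = -1` if it lies above. -/
theorem integral_indicator_eq_sum_crossings {ι : Type*} {g A : ℝ → ℝ} (hg : Continuous g)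
    (hA : ∀ t, HasDerivAt A (g t) t) {S : Set ℝ} (hS : Bornology.IsBounded S)
    (T : Finset ι) (τ σ : ι → ℝ) (hinj : Set.InjOn τ T)
    (hloc : ∀ x, (∀ e ∈ T, τ e ≠ x) → ∀ᶠ y in 𝓝 x, (y ∈ S ↔ x ∈ S))
    (hjump : ∀ e ∈ T, (σ e = 1 ∧ (∀ᶠ y in 𝓝[<] (τ e), y ∈ S) ∧ ∀ᶠ y in 𝓝[>] (τ e), y ∉ S) ∨
      (σ e = -1 ∧ (∀ᶠ y in 𝓝[<] (τ e), y ∉ S) ∧ ∀ᶠ y in 𝓝[>] (τ e), y ∈ S)) :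
    ∫ t, S.indicator g t = ∑ e ∈ T, σ e * A (τ e) := by
  classical
  -- Without crossings S is clopen, hence empty or the whole line, and the line is unbounded.
  rcases T.eq_empty_or_nonempty with rfl | ⟨e₀, he₀⟩
  · have hS0 : S = ∅ := by
      have hclopen : frontier S = ∅ := by
        refine eq_empty_of_forall_notMem fun x hx => ?_
        have h := hloc x (by simp)
        rcases (mem_closure_iff_frequently.1 hx.1).and_eventually h |>.exists with ⟨y, hy, hyx⟩
        exact hx.2 (mem_interior_iff_mem_nhds.2 (by
          filter_upwards [h] with z hz
          exact hz.2 (hyx.1 hy)))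
      rcases frontier_eq_empty_iff.1 hclopen with h | h
      · exact h
      · exact absurd (h ▸ hS) fun hb =>
          noncompact_univ ℝ (Metric.isCompact_of_isClosed_isBounded isClosed_univ hb)
    simp [hS0]
  have : Nonempty ι := ⟨e₀⟩
  obtain ⟨M, hM⟩ := (hS.union (T.finite_toSet.image τ).isBounded).subset_closedBall 0
  rw [Real.closedBall_eq_Icc, zero_sub, zero_add] at hM
  -- The margin 1 puts S and all crossings strictly inside, so that χ and the boundary terms vanish
  -- at ±b.
  set b := M + 1 with hb
  have hMT : ∀ e ∈ T, τ e ∈ Ioo (-b) b := fun e he => by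
    have h := hM (Or.inr (mem_image_of_mem τ he))
    exact ⟨by linarith [h.1], by linarith [h.2]⟩
  have hMS : ∀ x ∈ S, x ∈ Ioo (-b) b := fun x hx => by
    have h := hM (Or.inl hx)
    exact ⟨by linarith [h.1], by linarith [h.2]⟩
  have hbb : -b < b := (hMT e₀ he₀).1.trans (hMT e₀ he₀).2
  set χ : ℝ → ℝ := S.indicator 1 with hχ
  have hχ1 : ∀ y, y ∈ S → χ y = 1 := fun y hy => by simp [hχ, hy]
  have hχ0 : ∀ y, y ∉ S → χ y = 0 := fun y hy => by simp [hχ, hy]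
  obtain ⟨-, h⟩ := integral_mul_eq_sum_jumps (σ := fun t => σ (Function.invFunOn τ T t)) hg hA
    (T.image τ) χ (-b) b hbb
    (fun t ht => by
      obtain ⟨e, he, rfl⟩ := Finset.mem_image.1 ht
      exact hMT e he)
    (fun x _ hx => by
      filter_upwards [hloc x fun e he hex => hx (Finset.mem_image.2 ⟨e, he, hex⟩)] with y hy
      by_cases hxS : x ∈ S
      · rw [hχ1 x hxS, hχ1 y (hy.2 hxS)]
      · rw [hχ0 x hxS, hχ0 y (fun h => hxS (hy.1 h))])
    (fun t ht => by
      obtain ⟨e, he, rfl⟩ := Finset.mem_image.1 ht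
      rw [hinj.leftInvOn_invFunOn he]
      rcases hjump e he with ⟨hσ, hl, hr⟩ | ⟨hσ, hl, hr⟩
      · exact ⟨1, 0, by rw [hσ, sub_zero], hl.mono hχ1, hr.mono hχ0⟩
      · exact ⟨0, 1, by rw [hσ, zero_sub], hl.mono hχ0, hr.mono hχ1⟩)
  rw [Finset.sum_image hinj, hχ0 b fun h => (hMS b h).2.false,
    hχ0 (-b) fun h => (hMS _ h).1.false] at h
  have hind : ∀ t, S.indicator g t = χ t * g t := fun t => by
    by_cases ht : t ∈ S <;> simp [hχ, ht]
  have hsupp : Function.support (fun t => χ t * g t) ⊆ Ioc (-b) b := fun t ht => by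
    by_cases htS : t ∈ S
    · exact Ioo_subset_Ioc_self (hMS t htS)
    · exact absurd (by simp [hχ0 t htS]) ht
  simp only [hind]
  rw [← intervalIntegral.integral_eq_integral_of_support_subset hsupp, h, zero_mul, zero_mul,
    sub_zero, add_zero]
  exact Finset.sum_congr rfl fun e he => by rw [hinj.leftInvOn_invFunOn he]

/-! ### Arcs with regular abscissa and change of variables -/

/-- Subdivision of an interval at the points of a finite set. -/
theorem exists_subdivision (Z : Finset ℝ) : ∀ a b : ℝ, a < b → ∃ E : Finset (ℝ × ℝ),
    (∀ e ∈ E, a ≤ e.1 ∧ e.1 < e.2 ∧ e.2 ≤ b ∧ ∀ s ∈ Ioo e.1 e.2, s ∉ Z) ∧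
    (∀ e ∈ E, ∀ e' ∈ E, ∀ s, s ∈ Ioo e.1 e.2 → s ∈ Ioo e'.1 e'.2 → e = e') ∧
    (∀ s ∈ Icc a b, s = a ∨ s = b ∨ s ∈ Z ∨ ∃ e ∈ E, s ∈ Ioo e.1 e.2) ∧
    ∀ f : ℝ → ℝ, ContinuousOn f (Icc a b) → ∫ s in a..b, f s = ∑ e ∈ E, ∫ s in e.1..e.2, f s := by
  classical
  induction Z using Finset.induction_on with
  | empty =>
    intro a b hab
    refine ⟨{(a, b)}, ?_, ?_, ?_, ?_⟩
    · simp [hab]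
    · simp only [Finset.mem_singleton]
      rintro e rfl e' rfl s _ _
      rfl
    · intro s hs
      rcases hs.1.eq_or_lt with h | h
      · exact Or.inl h.symm
      rcases hs.2.eq_or_lt with h' | h'
      · exact Or.inr (Or.inl h')
      exact Or.inr (Or.inr (Or.inr ⟨_, Finset.mem_singleton_self _, h, h'⟩))
    · simp
  | insert t Z _ ih =>
    intro a b hab
    -- Both halves use the induction hypothesis for the same Z, hence the quantification over a and
    -- b.
    by_cases ht : t ∈ Ioo a b
    · obtain ⟨E₁, h1, h2, h3, h4⟩ := ih a t ht.1
      obtain ⟨E₂, k1, k2, k3, k4⟩ := ih t b ht.2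
      have hlt : ∀ e ∈ E₁, ∀ e' ∈ E₂, ∀ s, s ∈ Ioo e.1 e.2 → s ∈ Ioo e'.1 e'.2 → False := by
        intro e he e' he' s hs hs'
        have := (h1 e he).2.2.1
        have := (k1 e' he').1
        linarith [hs.2, hs'.1]
      refine ⟨E₁ ∪ E₂, ?_, ?_, ?_, ?_⟩
      · intro e he
        rcases Finset.mem_union.1 he with he | he
        · obtain ⟨p1, p2, p3, p4⟩ := h1 e he
          refine ⟨p1, p2, p3.trans ht.2.le, fun s hs => ?_⟩
          rw [Finset.mem_insert, not_or]
          exact ⟨(hs.2.trans_le p3).ne, p4 s hs⟩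
        · obtain ⟨p1, p2, p3, p4⟩ := k1 e he
          refine ⟨ht.1.le.trans p1, p2, p3, fun s hs => ?_⟩
          rw [Finset.mem_insert, not_or]
          exact ⟨(p1.trans_lt hs.1).ne', p4 s hs⟩
      · intro e he e' he' s hs hs'
        rcases Finset.mem_union.1 he with he | he <;> rcases Finset.mem_union.1 he' with he' | he'
        · exact h2 e he e' he' s hs hs'
        · exact (hlt e he e' he' s hs hs').elim
        · exact (hlt e' he' e he s hs' hs).elim
        · exact k2 e he e' he' s hs hs'
      · intro s hs
        rcases le_total s t with hst | hst
        · rcases h3 s ⟨hs.1, hst⟩ with h | h | h | ⟨e, he, h⟩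
          · exact Or.inl h
          · exact Or.inr (Or.inr (Or.inl (h ▸ Finset.mem_insert_self _ _)))
          · exact Or.inr (Or.inr (Or.inl (Finset.mem_insert_of_mem h)))
          · exact Or.inr (Or.inr (Or.inr ⟨e, Finset.mem_union_left _ he, h⟩))
        · rcases k3 s ⟨hst, hs.2⟩ with h | h | h | ⟨e, he, h⟩
          · exact Or.inr (Or.inr (Or.inl (h ▸ Finset.mem_insert_self _ _)))
          · exact Or.inr (Or.inl h)
          · exact Or.inr (Or.inr (Or.inl (Finset.mem_insert_of_mem h)))
          · exact Or.inr (Or.inr (Or.inr ⟨e, Finset.mem_union_right _ he, h⟩))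
      · intro f hf
        have hf1 : ContinuousOn f (Icc a t) := hf.mono (Icc_subset_Icc_right ht.2.le)
        have hf2 : ContinuousOn f (Icc t b) := hf.mono (Icc_subset_Icc_left ht.1.le)
        rw [Finset.sum_union, ← h4 f hf1, ← k4 f hf2,
          intervalIntegral.integral_add_adjacent_intervals
            (hf1.intervalIntegrable_of_Icc ht.1.le) (hf2.intervalIntegrable_of_Icc ht.2.le)]
        rw [Finset.disjoint_left]
        intro e he he'
        obtain ⟨s, hs⟩ := nonempty_Ioo.2 (h1 e he).2.1
        exact hlt e he e he' s hs hs
    · obtain ⟨E, h1, h2, h3, h4⟩ := ih a b hab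
      refine ⟨E, fun e he => ?_, h2, fun s hs => ?_, h4⟩
      · obtain ⟨p1, p2, p3, p4⟩ := h1 e he
        refine ⟨p1, p2, p3, fun s hs => ?_⟩
        rw [Finset.mem_insert, not_or]
        refine ⟨fun hst => ht ?_, p4 s hs⟩
        rw [← hst]
        exact ⟨p1.trans_lt hs.1, hs.2.trans_le p3⟩
      · rcases h3 s hs with h | h | h | h
        · exact Or.inl h
        · exact Or.inr (Or.inl h)
        · exact Or.inr (Or.inr (Or.inl (Finset.mem_insert_of_mem h)))
        · exact Or.inr (Or.inr (Or.inr h))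

/-- A rational curve consists of finitely many arcs over which `x` is regular, and of points and
arcs with finitely many abscissas, which do not contribute to line integrals with respect to `x`. -/
theorem RationalBezier.exists_arcs {m : ℕ} (c : RationalBezier m) :
    ∃ (E : Finset (ℝ × ℝ)) (B : Set ℝ), B.Finite ∧
      (∀ e ∈ E, 0 ≤ e.1 ∧ e.1 < e.2 ∧ e.2 ≤ 1 ∧ ∀ s ∈ Ioo e.1 e.2, deriv c.x s ≠ 0) ∧
      (∀ e ∈ E, ∀ e' ∈ E, ∀ s, s ∈ Ioo e.1 e.2 → s ∈ Ioo e'.1 e'.2 → e = e') ∧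
      (∀ s ∈ Icc (0 : ℝ) 1, c.x s ∉ B → ∃ e ∈ E, s ∈ Ioo e.1 e.2) ∧
      ∀ h : ℝ → ℝ, ContinuousOn h (Icc 0 1) →
        ∫ s in (0 : ℝ)..1, h s * deriv c.x s = ∑ e ∈ E, ∫ s in e.1..e.2, h s * deriv c.x s := by
  classical
  -- Either x is constant and the curve contributes nothing, or x' has finitely many zeros, at which
  -- the curve is cut.
  by_cases hD : c.numDerivX = 0
  · have hd : ∀ s ∈ Icc (0 : ℝ) 1, deriv c.x s = 0 := fun s hs => by
      rw [c.deriv_x (c.w_ne_zero hs), hD]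
      simp
    have hconst : ∀ s ∈ Icc (0 : ℝ) 1, c.x s = c.x 0 := by
      refine constant_of_has_deriv_right_zero c.continuousOn_x fun s hs => ?_
      have hs' := Ico_subset_Icc_self hs
      have h := (c.hasDerivAt_x (c.w_ne_zero hs')).hasDerivWithinAt (s := Ici s)
      simpa [hD] using h
    refine ⟨∅, {c.x 0}, finite_singleton _, by simp, by simp, ?_, ?_⟩
    · intro s hs hB
      exact absurd (hconst s hs) hB
    · intro h _
      rw [Finset.sum_empty]
      refine (intervalIntegral.integral_congr fun s hs => ?_).trans
        intervalIntegral.integral_zero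
      rw [uIcc_of_le zero_le_one] at hs
      simp only [hd s hs, mul_zero]
  · obtain ⟨E, h1, h2, h3, h4⟩ := exists_subdivision c.numDerivX.roots.toFinset 0 1 one_pos
    refine ⟨E, c.x '' ({0, 1} ∪ c.numDerivX.roots.toFinset), ?_, ?_, h2, ?_, ?_⟩
    · exact ((toFinite _).union (Finset.finite_toSet _)).image _
    · intro e he
      obtain ⟨p1, p2, p3, p4⟩ := h1 e he
      refine ⟨p1, p2, p3, fun s hs hs0 => p4 s hs ?_⟩
      have hw := c.w_ne_zero (s := s) ⟨p1.trans hs.1.le, hs.2.le.trans p3⟩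
      rw [c.deriv_x hw, div_eq_zero_iff] at hs0
      rw [Multiset.mem_toFinset, Polynomial.mem_roots hD]
      exact hs0.resolve_right (pow_ne_zero 2 hw)
    · intro s hs hB
      rcases h3 s hs with h | h | h | h
      · exact (hB ⟨s, by simp [h], rfl⟩).elim
      · exact (hB ⟨s, by simp [h], rfl⟩).elim
      · exact (hB ⟨s, Or.inr h, rfl⟩).elim
      · exact h
    · intro h hh
      exact h4 _ (hh.mul c.continuousOn_deriv_x)

/-- Change of variables on an arc over which `x` is regular. -/
theorem integral_mul_deriv_eq_integral_indicator {x h : ℝ → ℝ} {u v : ℝ} (huv : u < v)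
    (hx : ContinuousOn x (Icc u v)) (hx' : ∀ s ∈ Ioo u v, deriv x s ≠ 0)
    (hh : IntegrableOn (fun s => h s * deriv x s) (Ioo u v)) :
    InjOn x (Ioo u v) ∧
    Integrable ((x '' Ioo u v).indicator fun a =>
      (SignType.sign (deriv x (Function.invFunOn x (Ioo u v) a)) : ℝ) *
        h (Function.invFunOn x (Ioo u v) a)) ∧
    ∫ s in u..v, h s * deriv x s = ∫ a, (x '' Ioo u v).indicator (fun a =>
      (SignType.sign (deriv x (Function.invFunOn x (Ioo u v) a)) : ℝ) *
        h (Function.invFunOn x (Ioo u v) a)) a := by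
  have hinj : InjOn x (Ioo u v) := by
    have key : ∀ s ∈ Ioo u v, ∀ t ∈ Ioo u v, s < t → x s ≠ x t := by
      intro s hs t ht hst heq
      obtain ⟨r, hr, hr0⟩ := exists_deriv_eq_zero hst
        (hx.mono (Icc_subset_Icc hs.1.le ht.2.le)) heq
      exact hx' r ⟨hs.1.trans hr.1, hr.2.trans ht.2⟩ hr0
    intro s hs t ht heq
    rcases lt_trichotomy s t with h | h | h
    · exact (key s hs t ht h heq).elim
    · exact h
    · exact (key t ht s hs h heq.symm).elim
  have hd : ∀ s ∈ Ioo u v, HasDerivWithinAt x (deriv x s) (Ioo u v) s := fun s hs =>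
    (differentiableAt_of_deriv_ne_zero (hx' s hs)).hasDerivAt.hasDerivWithinAt
  -- The substitution produces |x'|; the sign factor restores x' and later becomes the sign of a
  -- crossing.
  have hcongr : EqOn (fun s => |deriv x s| • ((SignType.sign
      (deriv x (Function.invFunOn x (Ioo u v) (x s))) : ℝ) *
        h (Function.invFunOn x (Ioo u v) (x s)))) (fun s => h s * deriv x s) (Ioo u v) := by
    intro s hs
    simp only [hinj.leftInvOn_invFunOn hs, smul_eq_mul]
    rw [← mul_assoc, abs_mul_sign, mul_comm]
  have hmeas : MeasurableSet (x '' Ioo u v) :=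
    measurableSet_Ioo.image_of_continuousOn_injOn
      (hx.mono Ioo_subset_Icc_self) hinj
  refine ⟨hinj, ?_, ?_⟩
  · rw [integrable_indicator_iff hmeas,
      integrableOn_image_iff_integrableOn_abs_deriv_smul measurableSet_Ioo hd hinj]
    exact hh.congr_fun hcongr.symm measurableSet_Ioo
  · rw [integral_indicator hmeas,
      integral_image_eq_integral_abs_deriv_smul measurableSet_Ioo hd hinj,
      setIntegral_congr_fun measurableSet_Ioo hcongr, intervalIntegral.integral_of_le huv.le,
      integral_Ioc_eq_integral_Ioo]

/-! ### The region near a regular boundary point -/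

/-- A secant vector `(θ ε b, -(ε a))` between the vertical and the normal directions is not close to
a multiple of the tangent vector `(a, b)` with `a ≠ 0`. -/
theorem false_of_abs_sub_tangent_le {a b θ ε u : ℝ} (ha : a ≠ 0) (hε : ε ≠ 0) (hθ : θ ∈ Icc (0 : ℝ) 1)
    (h1 : |θ * ε * b - u * a| ≤ |a| ^ 3 / (4 * (|a| + |b|) ^ 2) * |u|)
    (h2 : |-(ε * a) - u * b| ≤ |a| ^ 3 / (4 * (|a| + |b|) ^ 2) * |u|) : False := by
  have hA : 0 < |a| := abs_pos.2 ha
  have hB : 0 ≤ |b| := abs_nonneg b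
  have hE : 0 < |ε| := abs_pos.2 hε
  have hS : 0 < |a| + |b| := by positivity
  -- The tolerance is small enough that |u| |a| ≤ 2 |ε| |b| (first coordinate) and |ε| a² ≤ η |u|
  -- (|a| + |b|) (product with the normal (b, -a)) together force 4 (|a| + |b|) ≤ 2 |b|.
  set η := |a| ^ 3 / (4 * (|a| + |b|) ^ 2) with hη
  have hη4 : η * (4 * (|a| + |b|) ^ 2) = |a| ^ 3 := div_mul_cancel₀ _ (by positivity)
  have hη0 : 0 ≤ η := by positivity
  have hηa : η ≤ |a| / 2 := by
    rw [hη, div_le_iff₀ (by positivity)]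
    have : |a| * |a| ^ 2 ≤ |a| * (|a| + |b|) ^ 2 := by gcongr; linarith
    nlinarith [pow_pos hA 3, mul_pos hA (pow_pos hS 2)]
  have hu : |u| * |a| ≤ 2 * (|ε| * |b|) := by
    have e1 : |u * a| ≤ |θ * ε * b - u * a| + |θ * ε * b| := by
      have := abs_sub (θ * ε * b) (θ * ε * b - u * a)
      rw [sub_sub_cancel] at this
      linarith
    have e2 : |θ * ε * b| ≤ |ε| * |b| := by
      rw [abs_mul, abs_mul, abs_of_nonneg hθ.1, mul_assoc]
      exact mul_le_of_le_one_left (by positivity) hθ.2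
    rw [abs_mul] at e1
    have e3 : η * |u| ≤ |a| / 2 * |u| := by gcongr
    linarith
  have hdot : |ε| * |a| ^ 2 ≤ η * |u| * (|a| + |b|) := by
    have e1 : |ε| * |a| ^ 2 ≤ |ε * (θ * b ^ 2 + a ^ 2)| := by
      rw [abs_mul, sq_abs]
      gcongr
      rw [abs_of_nonneg (by have := hθ.1; positivity)]
      have := mul_nonneg hθ.1 (sq_nonneg b)
      linarith
    have e2 : ε * (θ * b ^ 2 + a ^ 2) = (θ * ε * b - u * a) * b - (-(ε * a) - u * b) * a := by ring
    rw [e2] at e1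
    have e3 := abs_sub ((θ * ε * b - u * a) * b) ((-(ε * a) - u * b) * a)
    rw [abs_mul, abs_mul (-(ε * a) - u * b)] at e3
    have e4 := mul_le_mul_of_nonneg_right h1 hB
    have e5 := mul_le_mul_of_nonneg_right h2 hA.le
    linarith
  have h3 : |ε| * |a| ^ 3 ≤ |ε| * (2 * η * |b| * (|a| + |b|)) := by
    have := mul_le_mul_of_nonneg_right hdot hA.le
    have := mul_le_mul_of_nonneg_left hu (mul_nonneg hη0 hS.le)
    linarith
  have h4 := le_of_mul_le_mul_left h3 hE
  have hηpos : 0 < η := by positivity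
  rw [← hη4] at h4
  nlinarith [mul_pos hηpos (mul_pos hS hA), mul_nonneg hηpos.le (mul_nonneg hS.le hB)]

namespace IsBoundedBy

variable {n : ℕ} {m : Fin n → ℕ} {Ω : Set (ℝ × ℝ)} {c : ∀ i, RationalBezier (m i)}

/-- Near an inner point of a curve, the boundary consists of points of the same curve with nearby
parameters. -/
theorem eventually_frontier (hΩ : IsBoundedBy Ω c) (i : Fin n) {s : ℝ} (hs : s ∈ Ioo (0 : ℝ) 1)
    {V : Set ℝ} (hV : V ∈ 𝓝 s) :
    ∀ᶠ q in 𝓝 ((c i).point s), q ∈ frontier Ω → ∃ t ∈ V, (c i).point t = q := by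
  classical
  obtain ⟨W, hWV, hW, hsW⟩ := mem_nhds_iff.1 hV
  -- K is the boundary traced without the parameters in W on curve i. It is compact and, as the
  -- curves are simple, misses the point.
  let K : Set (ℝ × ℝ) := ⋃ j, (c j).point '' (Icc 0 1 \ (if j = i then W else ∅))
  have hK : IsClosed K := isClosed_iUnion_of_finite fun j => by
    refine ((isCompact_Icc.diff ?_).image_of_continuousOn
      ((c j).continuousOn_point.mono sdiff_subset)).isClosed
    split_ifs
    exacts [hW, isOpen_empty]
  have hp : (c i).point s ∉ K := by
    intro h
    obtain ⟨j, t, ⟨ht, htW⟩, hpt⟩ := mem_iUnion.1 h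
    obtain ⟨rfl, rfl⟩ := hΩ.simple i j s hs t ht hpt.symm
    rw [if_pos rfl] at htW
    exact htW hsW
  filter_upwards [hK.isOpen_compl.mem_nhds hp] with q hq hqf
  rw [hΩ.frontier_eq] at hqf
  obtain ⟨j, t, ht, rfl⟩ := mem_iUnion.1 hqf
  by_cases htW : t ∈ (if j = i then W else ∅)
  · split_ifs at htW with hji
    · subst hji
      exact ⟨t, hWV htW, rfl⟩
    · exact htW.elim
  · exact (hq (mem_iUnion.2 ⟨j, t, ⟨ht, htW⟩, rfl⟩)).elim

/-- Close to a point of the boundary where `x' ≠ 0`, the segments between the vertical and the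
normal at the point do not meet the boundary. -/
theorem eventually_notMem_frontier (hΩ : IsBoundedBy Ω c) (i : Fin n) {s : ℝ}
    (hs : s ∈ Ioo (0 : ℝ) 1) (hx : deriv (c i).x s ≠ 0) :
    ∀ᶠ ε in 𝓝[≠] (0 : ℝ), ∀ θ ∈ Icc (0 : ℝ) 1,
      ((c i).x s + θ * ε * deriv (c i).y s, (c i).y s - ε * deriv (c i).x s) ∉ frontier Ω := by
  have hw := (c i).w_ne_zero (Ioo_subset_Icc_self hs)
  have hdx := ((c i).hasDerivAt_x hw).differentiableAt.hasDerivAt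
  have hdy := ((c i).hasDerivAt_y hw).differentiableAt.hasDerivAt
  set a := deriv (c i).x s
  set b := deriv (c i).y s
  have hη : 0 < |a| ^ 3 / (4 * (|a| + |b|) ^ 2) := by
    have := abs_pos.2 hx
    positivity
  have hV := ((hasDerivAt_iff_isLittleO.1 hdx).def hη).and ((hasDerivAt_iff_isLittleO.1 hdy).def hη)
  obtain ⟨r, hr, hball⟩ := Metric.eventually_nhds_iff.1 (hΩ.eventually_frontier i hs hV)
  have hεb : ∀ᶠ ε in 𝓝 (0 : ℝ), |ε * b| < r := by
    have : Tendsto (fun ε : ℝ => |ε * b|) (𝓝 0) (𝓝 |0 * b|) := by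
      apply Continuous.tendsto
      fun_prop
    rw [zero_mul, abs_zero] at this
    exact this.eventually (gt_mem_nhds hr)
  have hεa : ∀ᶠ ε in 𝓝 (0 : ℝ), |ε * a| < r := by
    have : Tendsto (fun ε : ℝ => |ε * a|) (𝓝 0) (𝓝 |0 * a|) := by
      apply Continuous.tendsto
      fun_prop
    rw [zero_mul, abs_zero] at this
    exact this.eventually (gt_mem_nhds hr)
  filter_upwards [self_mem_nhdsWithin, eventually_nhdsWithin_of_eventually_nhds hεb,
    eventually_nhdsWithin_of_eventually_nhds hεa] with ε hε hb ha θ hθ hf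
  have hθb : |θ * ε * b| < r := by
    rw [mul_assoc, abs_mul, abs_of_nonneg hθ.1]
    exact (mul_le_of_le_one_left (abs_nonneg _) hθ.2).trans_lt hb
  obtain ⟨t, ⟨ht1, ht2⟩, hpt⟩ := hball (by
    rw [Prod.dist_eq, max_lt_iff]
    simp only [RationalBezier.point, Real.dist_eq, add_sub_cancel_left, sub_sub_cancel_left,
      abs_neg]
    exact ⟨hθb, ha⟩) hf
  have hpx : (c i).x t = (c i).x s + θ * ε * b := congrArg Prod.fst hpt
  have hpy : (c i).y t = (c i).y s - ε * a := congrArg Prod.snd hpt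
  rw [hpx, smul_eq_mul, add_sub_cancel_left, Real.norm_eq_abs, Real.norm_eq_abs] at ht1
  rw [hpy, smul_eq_mul, sub_sub_cancel_left, Real.norm_eq_abs, Real.norm_eq_abs] at ht2
  exact false_of_abs_sub_tangent_le hx hε hθ ht1 ht2

/-- At a point of the boundary where `x' ≠ 0`, the region lies vertically on one side. -/
theorem eventually_vertical (hΩ : IsBoundedBy Ω c) (i : Fin n) {s : ℝ}
    (hs : s ∈ Ioo (0 : ℝ) 1) (hx : deriv (c i).x s ≠ 0) :
    ∀ᶠ ε in 𝓝[>] (0 : ℝ),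
      ((c i).x s, (c i).y s - ε * deriv (c i).x s) ∈ interior Ω ∧
      ((c i).x s, (c i).y s + ε * deriv (c i).x s) ∉ interior Ω := by
  classical
  have hseg := hΩ.eventually_notMem_frontier i hs hx
  -- The segment from the vertical to the normal displacement avoids the frontier, so membership in
  -- Ω is constant along it.
  have hiff : ∀ ε : ℝ, (∀ θ ∈ Icc (0 : ℝ) 1,
      ((c i).x s + θ * ε * deriv (c i).y s, (c i).y s - ε * deriv (c i).x s) ∉ frontier Ω) →
      (((c i).x s + ε * deriv (c i).y s, (c i).y s - ε * deriv (c i).x s) ∈ Ω ↔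
        ((c i).x s, (c i).y s - ε * deriv (c i).x s) ∈ Ω) := by
    intro ε h
    let γ : ℝ → ℝ × ℝ := fun θ =>
      ((c i).x s + θ * ε * deriv (c i).y s, (c i).y s - ε * deriv (c i).x s)
    have hγ : Continuous γ := by fun_prop
    have h1 := eq_left_of_eventually_eq (χ := fun θ => if γ θ ∈ Ω then (1 : ℝ) else 0)
      (a := 0) (b := 1) (fun θ hθ => by
        filter_upwards [hγ.continuousAt.eventually
          (eventually_mem_iff_of_notMem_frontier (h θ hθ))] with y hy
        simp only [hy]) 1 (right_mem_Icc.2 zero_le_one)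
    have h0' : γ 0 = ((c i).x s, (c i).y s - ε * deriv (c i).x s) := by simp [γ]
    have h1' : γ 1 = ((c i).x s + ε * deriv (c i).y s, (c i).y s - ε * deriv (c i).x s) := by
      simp [γ]
    rw [← h0', ← h1']
    by_cases k1 : γ 1 ∈ Ω <;> by_cases k0 : γ 0 ∈ Ω <;> simp [k0, k1] at h1 ⊢
  -- The outer side is the same segment statement at -ε.
  have hneg : Tendsto (fun ε : ℝ => -ε) (𝓝[>] 0) (𝓝[≠] 0) := by
    refine tendsto_nhdsWithin_iff.2 ⟨?_, ?_⟩
    · have : Tendsto (fun ε : ℝ => -ε) (𝓝 0) (𝓝 (-0)) := continuous_neg.tendsto 0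
      rw [neg_zero] at this
      exact this.mono_left nhdsWithin_le_nhds
    · filter_upwards [self_mem_nhdsWithin] with ε hε
      exact neg_ne_zero.2 (ne_of_gt hε)
  filter_upwards [hΩ.inward_normal i s hs fun h => hx h.1,
    hseg.filter_mono (nhdsWithin_mono 0 fun ε hε => ne_of_gt hε), hneg.eventually hseg]
    with ε hn hpos hneg
  constructor
  · by_contra h
    refine hpos 0 (left_mem_Icc.2 zero_le_one) ⟨?_, ?_⟩
    · rw [zero_mul, zero_mul, add_zero]
      exact subset_closure ((hiff ε hpos).1 hn.1)
    · rwa [zero_mul, zero_mul, add_zero]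
  · intro h
    have h' := (hiff (-ε) hneg).2 (by simpa using interior_subset h)
    refine hn.2 ?_
    simpa [← sub_eq_add_neg] using h'

/-! ### Green's theorem by vertical slices -/

/-- Green's theorem for a region bounded by rational curves and the line integral of
`A_f(x, y) dx`. -/
theorem setIntegral_evalAt_eq (hΩ : IsBoundedBy Ω c) (f : MvPolynomial (Fin 2) ℝ) (C : ℝ) :
    ∫ p in Ω, evalAt f p.1 p.2 =
      ∑ i, ∫ s in (0 : ℝ)..1, antideriv f C ((c i).x s) ((c i).y s) * deriv (c i).x s := by
  classical
  choose E B hB h1 h2 h3 h4 using fun i => (c i).exists_arcs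
  -- An index κ is an arc: a curve with a parameter interval. `par κ` inverts x on it, `T a`
  -- collects the arcs that cross the line over a, and `τ a κ` is the height of the crossing.
  let J : (Σ _ : Fin n, ℝ × ℝ) → Set ℝ := fun κ => Ioo κ.2.1 κ.2.2
  let par : (Σ _ : Fin n, ℝ × ℝ) → ℝ → ℝ := fun κ a => Function.invFunOn (c κ.1).x (J κ) a
  let I : Finset (Σ _ : Fin n, ℝ × ℝ) := Finset.univ.sigma E
  let τ : ℝ → (Σ _ : Fin n, ℝ × ℝ) → ℝ := fun a κ => (c κ.1).y (par κ a)
  let σ : ℝ → (Σ _ : Fin n, ℝ × ℝ) → ℝ := fun a κ =>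
    (SignType.sign (deriv (c κ.1).x (par κ a)) : ℝ)
  let T : ℝ → Finset (Σ _ : Fin n, ℝ × ℝ) := fun a => I.filter fun κ => a ∈ (c κ.1).x '' J κ
  have hI : ∀ κ ∈ I, κ.2 ∈ E κ.1 := fun κ hκ => (Finset.mem_sigma.1 hκ).2
  have hJ : ∀ κ ∈ I, J κ ⊆ Ioo 0 1 := fun κ hκ =>
    Ioo_subset_Ioo (h1 κ.1 κ.2 (hI κ hκ)).1 (h1 κ.1 κ.2 (hI κ hκ)).2.2.1
  have hcont : ∀ i, ContinuousOn (fun s => antideriv f C ((c i).x s) ((c i).y s)) (Icc 0 1) :=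
    fun i => (c i).continuousOn_antideriv f C
  have hsub : ∀ κ ∈ I, InjOn (c κ.1).x (J κ) ∧
      Integrable (((c κ.1).x '' J κ).indicator fun a => σ a κ *
        antideriv f C ((c κ.1).x (par κ a)) ((c κ.1).y (par κ a))) ∧
      ∫ s in κ.2.1..κ.2.2, antideriv f C ((c κ.1).x s) ((c κ.1).y s) * deriv (c κ.1).x s =
        ∫ a, ((c κ.1).x '' J κ).indicator (fun a => σ a κ *
          antideriv f C ((c κ.1).x (par κ a)) ((c κ.1).y (par κ a))) a := by
    intro κ hκ
    obtain ⟨p1, p2, p3, p4⟩ := h1 κ.1 κ.2 (hI κ hκ)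
    have hss : Icc κ.2.1 κ.2.2 ⊆ Icc 0 1 := Icc_subset_Icc p1 p3
    refine integral_mul_deriv_eq_integral_indicator
      (h := fun s => antideriv f C ((c κ.1).x s) ((c κ.1).y s)) p2
      ((c κ.1).continuousOn_x.mono hss) p4 ?_
    exact ((((hcont κ.1).mul (c κ.1).continuousOn_deriv_x).mono hss).integrableOn_Icc).mono_set
      Ioo_subset_Icc_self
  have hpar : ∀ a, ∀ κ ∈ T a, κ ∈ I ∧ par κ a ∈ J κ ∧ (c κ.1).x (par κ a) = a := by
    intro a κ hκ
    obtain ⟨hκI, hκa⟩ := Finset.mem_filter.1 hκ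
    exact ⟨hκI, Function.invFunOn_mem hκa, Function.invFunOn_eq hκa⟩
  have hpoint : ∀ a, ∀ κ ∈ T a, (c κ.1).point (par κ a) = (a, τ a κ) := fun a κ hκ =>
    Prod.ext (hpar a κ hκ).2.2 rfl
  have hτ : ∀ a, InjOn (τ a) (T a) := by
    intro a κ hκ κ' hκ' heq
    obtain ⟨q1, q2, -⟩ := hpar a κ hκ
    obtain ⟨r1, r2, -⟩ := hpar a κ' hκ'
    obtain ⟨hi, hs⟩ := hΩ.simple κ.1 κ'.1 (par κ a) (hJ κ q1 q2) (par κ' a)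
      (Ioo_subset_Icc_self (hJ κ' r1 r2)) (by
        rw [hpoint a κ hκ, hpoint a κ' hκ', heq])
    obtain ⟨i, e⟩ := κ
    obtain ⟨i', e'⟩ := κ'
    obtain rfl : i = i' := hi
    have := h2 i e (hI _ q1) e' (hI _ r1) _ q2 (hs ▸ r2)
    rw [this]
  have hae : ∀ᵐ a : ℝ, a ∉ ⋃ i, B i := (finite_iUnion hB).countable.ae_notMem volume
  have hslice : ∀ a, a ∉ ⋃ i, B i → ∀ t, (a, t) ∈ frontier Ω → ∃ κ ∈ T a, τ a κ = t := by
    intro a ha t hat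
    rw [hΩ.frontier_eq] at hat
    obtain ⟨i, s, hs, hst⟩ := mem_iUnion.1 hat
    have hxs : (c i).x s = a := congrArg Prod.fst hst
    have hys : (c i).y s = t := congrArg Prod.snd hst
    obtain ⟨e, he, hse⟩ := h3 i s hs fun h => ha (mem_iUnion.2 ⟨i, hxs ▸ h⟩)
    have hκI : (⟨i, e⟩ : Σ _ : Fin n, ℝ × ℝ) ∈ I := Finset.mem_sigma.2 ⟨Finset.mem_univ _, he⟩
    refine ⟨⟨i, e⟩, Finset.mem_filter.2 ⟨hκI, ⟨s, hse, hxs⟩⟩, ?_⟩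
    rw [← hys, ← hxs]
    exact congrArg (c i).y ((hsub _ hκI).1.leftInvOn_invFunOn hse)
  -- Almost every vertical slice of the frontier is finite. This allows passing from Ω, not assumed
  -- measurable, to its interior.
  have hnull : volume (frontier Ω) = 0 := by
    rw [Measure.volume_eq_prod, Measure.measure_prod_null isClosed_frontier.measurableSet]
    filter_upwards [hae] with a ha
    refine (((T a).finite_toSet.image (τ a)).subset fun t ht => ?_).measure_zero _
    obtain ⟨κ, hκ, h⟩ := hslice a ha t ht
    exact ⟨κ, hκ, h⟩
  have hinner : ∀ a, a ∉ ⋃ i, B i →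
      ∫ t, (Prod.mk a ⁻¹' interior Ω).indicator (fun t => evalAt f a t) t =
        ∑ κ ∈ T a, σ a κ * antideriv f C a (τ a κ) := by
    intro a ha
    refine integral_indicator_eq_sum_crossings ?_ (hasDerivAt_antideriv f C a) ?_ (T a) (τ a) (σ a)
      (hτ a) ?_ ?_
    · exact continuous_evalAt_right f a
    · refine (hΩ.bounded.image_snd).subset fun t ht => ?_
      exact ⟨(a, t), interior_subset ht, rfl⟩
    · intro t ht
      have hat : (a, t) ∉ frontier (interior Ω) := fun h => by
        obtain ⟨κ, hκ, h⟩ := hslice a ha t (frontier_interior_subset h)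
        exact ht κ hκ h
      exact (Continuous.prodMk_right a).continuousAt.eventually
        (eventually_mem_iff_of_notMem_frontier hat)
    · intro κ hκ
      obtain ⟨q1, q2, q3⟩ := hpar a κ hκ
      have hd := (h1 κ.1 κ.2 (hI κ q1)).2.2.2 _ q2
      have hv := hΩ.eventually_vertical κ.1 (hJ κ q1 q2) hd
      rw [q3] at hv
      set d := deriv (c κ.1).x (par κ a) with hdef
      change ∀ᶠ ε in 𝓝[>] (0 : ℝ), (a, τ a κ - ε * d) ∈ interior Ω ∧
        (a, τ a κ + ε * d) ∉ interior Ω at hv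
      -- Here g y is the displacement ε with y = τ - ε d or y = τ + ε d; the sign of d decides on
      -- which side of τ it is positive.
      have hlim : ∀ (l : Filter ℝ) (g : ℝ → ℝ), l ≤ 𝓝 (τ a κ) → Continuous g → g (τ a κ) = 0 →
          (∀ᶠ y in l, 0 < g y) → ∀ᶠ y in l, (a, τ a κ - g y * d) ∈ interior Ω ∧
            (a, τ a κ + g y * d) ∉ interior Ω := by
        intro l g hl hg hg0 hpos
        have h0 : Tendsto g l (𝓝 0) := by
          rw [← hg0]
          exact (hg.tendsto _).mono_left hl
        exact (tendsto_nhdsWithin_iff.2 ⟨h0, hpos⟩).eventually hv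
      have hbelow : ∀ y, τ a κ - (τ a κ - y) / d * d = y := fun y => by
        rw [div_mul_cancel₀ _ hd, sub_sub_cancel]
      have habove : ∀ y, τ a κ + (y - τ a κ) / d * d = y := fun y => by
        rw [div_mul_cancel₀ _ hd, add_sub_cancel]
      rcases hd.lt_or_gt with hneg | hpos
      · refine Or.inr ⟨by simp [σ, ← hdef, sign_neg hneg], ?_, ?_⟩
        · filter_upwards [hlim (𝓝[<] (τ a κ)) (fun y => (y - τ a κ) / d) nhdsWithin_le_nhds
            (by fun_prop) (by simp) (by
              filter_upwards [eventually_mem_nhdsWithin] with y hy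
              exact div_pos_of_neg_of_neg (sub_neg.2 hy) hneg)] with y hy
          exact fun h => hy.2 ((habove y).symm ▸ h)
        · filter_upwards [hlim (𝓝[>] (τ a κ)) (fun y => (τ a κ - y) / d) nhdsWithin_le_nhds
            (by fun_prop) (by simp) (by
              filter_upwards [eventually_mem_nhdsWithin] with y hy
              exact div_pos_of_neg_of_neg (sub_neg.2 hy) hneg)] with y hy
          exact hbelow y ▸ hy.1
      · refine Or.inl ⟨by simp [σ, ← hdef, sign_pos hpos], ?_, ?_⟩
        · filter_upwards [hlim (𝓝[<] (τ a κ)) (fun y => (τ a κ - y) / d) nhdsWithin_le_nhds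
            (by fun_prop) (by simp) (by
              filter_upwards [eventually_mem_nhdsWithin] with y hy
              exact div_pos (sub_pos.2 hy) hpos)] with y hy
          exact hbelow y ▸ hy.1
        · filter_upwards [hlim (𝓝[>] (τ a κ)) (fun y => (y - τ a κ) / d) nhdsWithin_le_nhds
            (by fun_prop) (by simp) (by
              filter_upwards [eventually_mem_nhdsWithin] with y hy
              exact div_pos (sub_pos.2 hy) hpos)] with y hy
          exact fun h => hy.2 ((habove y).symm ▸ h)
  have hΩint : interior Ω =ᵐ[volume] Ω := interior_ae_eq_of_null_frontier hnull
  have hcongr : ∀ a, ∑ κ ∈ T a, σ a κ * antideriv f C a (τ a κ) =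
      ∑ κ ∈ I, ((c κ.1).x '' J κ).indicator (fun a => σ a κ *
          antideriv f C ((c κ.1).x (par κ a)) ((c κ.1).y (par κ a))) a := by
    intro a
    rw [Finset.sum_filter]
    refine Finset.sum_congr rfl fun κ hκ => ?_
    by_cases h : a ∈ (c κ.1).x '' J κ
    · rw [if_pos h, indicator_of_mem h, (hpar a κ (Finset.mem_filter.2 ⟨hκ, h⟩)).2.2]
    · rw [if_neg h, indicator_of_notMem h]
  have hint : Integrable ((interior Ω).indicator fun p : ℝ × ℝ => evalAt f p.1 p.2) := by
    rw [integrable_indicator_iff isOpen_interior.measurableSet]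
    exact ((continuous_evalAt f).continuousOn.integrableOn_compact
      hΩ.bounded.isCompact_closure).mono_set (interior_subset.trans subset_closure)
  calc ∫ p in Ω, evalAt f p.1 p.2
      = ∫ p, (interior Ω).indicator (fun p : ℝ × ℝ => evalAt f p.1 p.2) p := by
        rw [integral_indicator isOpen_interior.measurableSet, setIntegral_congr_set hΩint]
    _ = ∫ a, ∫ t, (interior Ω).indicator (fun p : ℝ × ℝ => evalAt f p.1 p.2) (a, t) := by
        rw [Measure.volume_eq_prod] at hint ⊢
        exact integral_prod _ hint
    _ = ∫ a, ∑ κ ∈ I, ((c κ.1).x '' J κ).indicator (fun a => σ a κ *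
          antideriv f C ((c κ.1).x (par κ a)) ((c κ.1).y (par κ a))) a := by
        refine integral_congr_ae ?_
        filter_upwards [hae] with a ha
        rw [← hcongr a, ← hinner a ha]
        rfl
    _ = ∑ κ ∈ I, ∫ s in κ.2.1..κ.2.2,
          antideriv f C ((c κ.1).x s) ((c κ.1).y s) * deriv (c κ.1).x s := by
        rw [integral_finsetSum _ fun κ hκ => (hsub κ hκ).2.1]
        exact Finset.sum_congr rfl fun κ hκ => (hsub κ hκ).2.2.symm
    _ = _ := by
        rw [Finset.sum_sigma]
        exact Finset.sum_congr rfl fun i _ => (h4 i _ (hcont i)).symm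

end IsBoundedBy

end SpectralPE

end

theorem mainTheorem1 (k n : ℕ) (m : Fin n → ℕ) (c : ∀ i, SpectralPE.RationalBezier (m i))
    (Ω : Set (ℝ × ℝ)) (hΩ : SpectralPE.IsBoundedBy Ω c) :
    -- the line integrand is a rational function with denominator `w_i ^ (k + 3)`
    (∀ f : MvPolynomial (Fin 2) ℝ, f.totalDegree ≤ k → ∀ (C : ℝ) (i : Fin n),
      ∃ N : Polynomial ℝ, N.natDegree ≤ m i * (k + 3) ∧
        ∀ s : ℝ, (c i).w.eval s ≠ 0 →
          SpectralPE.antideriv f C ((c i).x s) ((c i).y s) * deriv (c i).x s =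
            N.eval s / (c i).w.eval s ^ (k + 3)) ∧
    -- the component rules exist
    Nonempty (SpectralPE.GaussRule ⌈((k : ℚ) + 1) / 2⌉₊) ∧
    (∀ i, ∃ R : SpectralPE.RationalRule (c i) k,
      Function.Injective R.node ∧ ∀ q, R.node q ∈ Set.Ioo (0 : ℝ) 1) ∧
    -- the number of points
    Fintype.card (SpectralPE.Index m k ⌈((k : ℚ) + 1) / 2⌉₊) =
      ⌈((k : ℚ) + 1) / 2⌉₊ * ∑ i, (m i * (k + 3) + 1) ∧
    -- exactness of the combined rule
    (∀ (G : SpectralPE.GaussRule ⌈((k : ℚ) + 1) / 2⌉₊) (R : ∀ i, SpectralPE.RationalRule (c i) k)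
        (C : ℝ) (f : MvPolynomial (Fin 2) ℝ), f.totalDegree ≤ k →
      ∫ p in Ω, SpectralPE.evalAt f p.1 p.2 =
        ∑ l, SpectralPE.qWeight c R G C l *
          SpectralPE.evalAt f (SpectralPE.qPoint c R G C l).1
            (SpectralPE.qPoint c R G C l).2) := by
  -- Since P ≥ (k + 1) / 2, the Gauss degree 2P - 1 is at least k.
  have hP : k < 2 * ⌈((k : ℚ) + 1) / 2⌉₊ := by
    have h := Nat.le_ceil (((k : ℚ) + 1) / 2)
    rw [div_le_iff₀ two_pos] at h
    have h' : k + 1 ≤ ⌈((k : ℚ) + 1) / 2⌉₊ * 2 := by exact_mod_cast h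
    omega
  refine ⟨fun f hf C i => SpectralPE.exists_antideriv_mul_deriv_eq (c i) hf C,
    SpectralPE.nonempty_gaussRule _, fun i => SpectralPE.exists_rationalRule (c i) k, ?_,
    fun G R C f hf => ?_⟩
  · simp [Fintype.card_prod, Fintype.card_sigma, mul_comm]
  · rw [hΩ.setIntegral_evalAt_eq f C, SpectralPE.sum_qWeight_mul_eq c R G hP C hf]
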